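/- Let $M$ be a connected smooth surface (2-manifold), let $r:M\to\mathbb{E}^3$ be a smooth immersion into Euclidean 3-space with a smooth unit normal field $N$, and give $M$ the induced metric. Let $A$ be the shape operator, defined by $dN(X)=-dr(AX)$. Fix a unit vector $\vec k$, let $\theta=\angle(N,\vec k)$ be the angle function, and let $U$ be the tangent part of $\vec k$, so that $\vec k=U+\cos\theta\,N$. The surface is minimal if $\operatorname{trace}A=0$ everywhere. $U$ is a principal direction if at every point $U\neq 0$ (that is, $\theta\in(0,\pi)$) and $AU=\kappa U$ for some $\kappa\in\mathbb{R}$; it is a canonical principal direction if moreover $\kappa\ne 0$ at every point. (1) $M$ is minimal, $U$ is a principal direction and $\theta$ is not constant if and only if, up to an isometry of $\mathbb{E}^3$, the immersion is given in local coordinates by $$r(x,y)=\left(\sqrt{x^2+c^2}\cos y,\ \sqrt{x^2+c^2}\sin y,\ c\ln\big(x+\sqrt{x^2+c^2}\big)\right)$$ for some real $c\neq0$. Precisely: there are $c\neq 0$ and an isometry $\Phi$ of $\mathbb{E}^3$ whose linear part maps $(0,0,1)$ to $\vec k$ or $-\vec k$, such that every point of $M$ has a neighbourhood with smooth coordinates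 $(x,y)$ in which the immersion is $\Phi$ composed with the map above. (2) $M$ is minimal with $U$ a canonical principal direction if and only if $r(M)$ is contained in a catenoid with axis parallel to $\vec k$, that is, in $\Phi\big(\{(u,v,w): u^2+v^2=c^2\cosh^2(w/c)\}\big)$ for some $c>0$ and some isometry $\Phi$ of $\mathbb{E}^3$ whose linear part maps $(0,0,1)$ to $\pm\vec k$. -/

import Mathlib

open scoped Manifold ContDiff

noncomputable section

/-- Euclidean 3-space. -/
abbrev E3 : Type := EuclideanSpace ℝ (Fin 3)

/-- The differential at `p` of an `E3`-valued map on a surface, as a linear map `T_p M → E3`;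
that is, `X ↦ ∇̃_X f` for the flat connection of `E3`. -/
def ambientDeriv {M : Type*} [TopologicalSpace M] [ChartedSpace (EuclideanSpace ℝ (Fin 2)) M]
    (f : M → E3) (p : M) : TangentSpace (𝓡 2) p →ₗ[ℝ] E3 :=
  (mfderiv (𝓡 2) 𝓘(ℝ, E3) f p).toLinearMap

/-- A surface `M` (smooth 2-manifold without boundary) smoothly immersed in Euclidean 3-space,
with a smooth unit normal field. `M` carries the metric induced by the immersion. -/
structure ImmersedSurface (M : Type*) [TopologicalSpace M]
    [ChartedSpace (EuclideanSpace ℝ (Fin 2)) M] where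
  /-- the immersion -/
  r : M → E3
  r_smooth : ContMDiff (𝓡 2) 𝓘(ℝ, E3) ∞ r
  r_immersion : ∀ p, Function.Injective (ambientDeriv r p)
  /-- the unit normal field -/
  N : M → E3
  N_smooth : ContMDiff (𝓡 2) 𝓘(ℝ, E3) ∞ N
  N_unit : ∀ p, ‖N p‖ = 1
  N_normal : ∀ (p : M) (X : TangentSpace (𝓡 2) p), inner ℝ (ambientDeriv r p X) (N p) = 0

namespace ImmersedSurface

variable {M : Type*} [TopologicalSpace M] [ChartedSpace (EuclideanSpace ℝ (Fin 2)) M]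
  (S : ImmersedSurface M)

/-- The tangent part of an ambient vector at `p`: its orthogonal projection to the tangent plane
`dr (T_p M)`, read as an element of `T_p M`. -/
def tangentPart (p : M) : E3 →ₗ[ℝ] TangentSpace (𝓡 2) p :=
  (LinearEquiv.ofInjective (ambientDeriv S.r p) (S.r_immersion p)).symm.toLinearMap ∘ₗ
    ((LinearMap.range (ambientDeriv S.r p)).orthogonalProjectionOnto).toLinearMap

/-- The shape operator `A` at `p`, given by the Weingarten formula `∇̃_X N = - A X`. -/
def shapeOperator (p : M) : Module.End ℝ (TangentSpace (𝓡 2) p) :=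
  -(S.tangentPart p ∘ₗ ambientDeriv S.N p)

/-- The angle function `θ` between the unit normal and the fixed direction `k`. -/
def angle (k : E3) (p : M) : ℝ := InnerProductGeometry.angle (S.N p) k

/-- The tangent part `U` of the fixed direction `k`. -/
def U (k : E3) (p : M) : TangentSpace (𝓡 2) p := S.tangentPart p k

/-- The surface is minimal: the trace of the shape operator vanishes identically. -/
def IsMinimal : Prop := ∀ p, LinearMap.trace ℝ _ (S.shapeOperator p) = 0

/-- `U` is a principal direction everywhere: at each point it is an eigenvector (in particular
nonzero, which says that the angle lies strictly between `0` and `π`) of the shape operator. -/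
def IsPrincipalU (k : E3) : Prop :=
  ∀ p, ∃ κ : ℝ, (S.shapeOperator p).HasEigenvector κ (S.U k p)

/-- `U` is a canonical principal direction: it is a principal direction whose principal
curvature is nowhere zero. -/
def IsCanonicalPrincipalU (k : E3) : Prop :=
  ∀ p, ∃ κ : ℝ, κ ≠ 0 ∧ (S.shapeOperator p).HasEigenvector κ (S.U k p)

/-- The angle function is constant. -/
def HasConstantAngle (k : E3) : Prop := ∃ θ₀ : ℝ, ∀ p, S.angle k p = θ₀

end ImmersedSurface

/-- The parametrization
`(x, y) ↦ (√(x² + c²) cos y, √(x² + c²) sin y, c ln (x + √(x² + c²)))`. -/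
def catenoidParam (c x y : ℝ) : E3 :=
  !₂[√(x ^ 2 + c ^ 2) * Real.cos y, √(x ^ 2 + c ^ 2) * Real.sin y,
    c * Real.log (x + √(x ^ 2 + c ^ 2))]

/-- The catenoid: the catenary of radius `c cosh (z / c)` at height `z`, rotated about
the third axis. -/
def catenoid (c : ℝ) : Set E3 :=
  {v | v 0 ^ 2 + v 1 ^ 2 = (c * Real.cosh (v 2 / c)) ^ 2}

/-- The isometry `Φ` of Euclidean space carries the direction of the third axis to the
(unoriented) direction `k`. -/
def CarriesAxisTo (Φ : E3 ≃ᵃⁱ[ℝ] E3) (k : E3) : Prop :=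
  Φ.linearIsometryEquiv (EuclideanSpace.single 2 1) = k ∨
    Φ.linearIsometryEquiv (EuclideanSpace.single 2 1) = -k

end

/-!
Let `G` be the inverse of the Gauss map of the catenoid of radius `1` with axis `k`, centred at the
origin. Its derivative at a unit vector is a multiple of a reflection of the tangent plane, in which
the tangent part `U` of `k` spans a fixed line. Hence `d(G ∘ N) = a • dr` for a function `a` on `M`
if and only if `A` is a multiple of that reflection, that is, if and only if `A` is trace-free with
eigenvector `U`. Since `d (a • dr) = 0` forces `da = 0` on a surface, `a` is then constant and
`G ∘ N = a • r + b`: the surface, scaled by `a` and translated, lies on the unit catenoid. The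
constant `a` vanishes exactly when the angle is constant, and also exactly when the principal
curvature of `U` vanishes, so both parts of the theorem describe the case `a ≠ 0`.
-/

section SecondDerivative

variable {E F : Type*} [NormedAddCommGroup E] [NormedSpace ℝ E] [NormedAddCommGroup F]
  [NormedSpace ℝ F] {h : E → ℝ} {x : E}

theorem differentiableAt_of_eventuallyEq_smul {f g : E → F} (hf : DifferentiableAt ℝ f x)
    (hg : DifferentiableAt ℝ g x) (hfx : f x ≠ 0) (hgf : ∀ᶠ y in nhds x, g y = h y • f y) :
    DifferentiableAt ℝ h x := by
  obtain ⟨ℓ, hℓ⟩ := SeparatingDual.exists_ne_zero (R := ℝ) hfx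
  have hℓf : DifferentiableAt ℝ (fun y => ℓ (f y)) x := (ℓ : F →L[ℝ] ℝ).differentiableAt.comp x hf
  have hℓg : DifferentiableAt ℝ (fun y => ℓ (g y)) x := (ℓ : F →L[ℝ] ℝ).differentiableAt.comp x hg
  refine (hℓg.fun_mul (hℓf.fun_inv hℓ)).congr_of_eventuallyEq ?_
  filter_upwards [hgf, hℓf.continuousAt.eventually_ne hℓ] with y hy hne
  rw [hy, map_smul, smul_eq_mul, mul_inv_cancel_right₀ hne]

theorem fderiv_smul_comm_of_fderiv_eq_smul {f g : E → F} (hf : ContDiffAt ℝ 2 f x)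
    (hg : ContDiffAt ℝ 2 g x) (hh : DifferentiableAt ℝ h x)
    (hgf : ∀ᶠ y in nhds x, fderiv ℝ g y = h y • fderiv ℝ f y) (u v : E) :
    fderiv ℝ h x u • fderiv ℝ f x v = fderiv ℝ h x v • fderiv ℝ f x u := by
  have hdf : DifferentiableAt ℝ (fderiv ℝ f) x :=
    (hf.fderiv_right (m := 1) le_rfl).differentiableAt one_ne_zero
  have hsnd : fderiv ℝ (fderiv ℝ g) x =
      h x • fderiv ℝ (fderiv ℝ f) x + (fderiv ℝ h x).smulRight (fderiv ℝ f x) :=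
    (Filter.EventuallyEq.fderiv_eq hgf).trans (hh.hasFDerivAt.smul hdf.hasFDerivAt).fderiv
  have hsymm := hg.isSymmSndFDerivAt (by simp) u v
  simpa [hsnd, (hf.isSymmSndFDerivAt (by simp)) u v] using hsymm

theorem eq_zero_of_forall_smul_comm (hE : 1 < Module.rank ℝ E) {ℓ : E →L[ℝ] ℝ}
    (hℓ : ∀ u v, ℓ u • v = ℓ v • u) : ℓ = 0 := by
  ext u
  by_contra hu
  have hspan (v : E) : ∃ t : ℝ, t • u = v :=
    ⟨(ℓ u)⁻¹ * ℓ v, by rw [mul_smul, ← hℓ, inv_smul_smul₀ hu]⟩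
  exact hE.not_ge (rank_le_one_iff.2 ⟨u, hspan⟩)

theorem hasFDerivAt_zero_of_fderiv_eq_smul (hE : 1 < Module.rank ℝ E) {f g : E → F}
    (hf : ContDiffAt ℝ 2 f x) (hg : ContDiffAt ℝ 2 g x)
    (hinj : Function.Injective (fderiv ℝ f x))
    (hgf : ∀ᶠ y in nhds x, fderiv ℝ g y = h y • fderiv ℝ f y) :
    HasFDerivAt h (0 : E →L[ℝ] ℝ) x := by
  have : Nontrivial E := rank_pos_iff_nontrivial.1 (zero_lt_one.trans hE)
  obtain ⟨v, hv⟩ := exists_ne (0 : E)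
  have happly {f : E → F} (hf : ContDiffAt ℝ 2 f x) :
      DifferentiableAt ℝ (fun y => fderiv ℝ f y v) x :=
    ((hf.fderiv_right (m := 1) le_rfl).differentiableAt one_ne_zero).clm_apply
      (differentiableAt_const v)
  have hh : DifferentiableAt ℝ h x := by
    refine differentiableAt_of_eventuallyEq_smul (happly hf) (happly hg) ?_
      (hgf.mono fun y hy => DFunLike.congr_fun hy v)
    exact (map_ne_zero_iff _ hinj).2 hv
  have hzero : fderiv ℝ h x = 0 := eq_zero_of_forall_smul_comm hE fun u v => hinj <| by
    simpa only [map_smul] using fderiv_smul_comm_of_fderiv_eq_smul hf hg hh hgf u v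
  exact hzero ▸ hh.hasFDerivAt

end SecondDerivative

section NormalDerivative

variable {E F : Type*} [NormedAddCommGroup E] [NormedSpace ℝ E] [NormedAddCommGroup F]
  [InnerProductSpace ℝ F]

theorem inner_fderiv_symm_of_inner_eq_zero {r N : E → F} {x : E} (hr : ContDiffAt ℝ 2 r x)
    (hN : DifferentiableAt ℝ N x)
    (hrN : ∀ᶠ y in nhds x, ∀ v, inner ℝ (fderiv ℝ r y v) (N y) = 0) (u v : E) :
    inner ℝ (fderiv ℝ r x u) (fderiv ℝ N x v) = inner ℝ (fderiv ℝ r x v) (fderiv ℝ N x u) := by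
  have hdr : DifferentiableAt ℝ (fderiv ℝ r) x :=
    (hr.fderiv_right (m := 1) le_rfl).differentiableAt one_ne_zero
  have hprod (u v : E) : inner ℝ (fderiv ℝ r x u) (fderiv ℝ N x v) +
      inner ℝ (fderiv ℝ (fderiv ℝ r) x v u) (N x) = 0 := by
    have hderiv := (hdr.hasFDerivAt.clm_apply (hasFDerivAt_const u x)).inner ℝ hN.hasFDerivAt
    have hconst := (hasFDerivAt_const (𝕜 := ℝ) (0 : ℝ) x).congr_of_eventuallyEq
      (hrN.mono fun y hy => hy u)
    simpa using DFunLike.congr_fun (hderiv.unique hconst) v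
  have hsymm := hr.isSymmSndFDerivAt (by simp) u v
  linarith [hprod u v, hsymm ▸ hprod v u]

end NormalDerivative

section Manifold

variable {E F : Type*} [NormedAddCommGroup E] [NormedSpace ℝ E] [NormedAddCommGroup F]
  [NormedSpace ℝ F] {M : Type*} [TopologicalSpace M] [ChartedSpace E M]

theorem hasMFDerivAt_iff_hasFDerivAt_chart {f : M → F} {p : M} {D : E →L[ℝ] F} :
    HasMFDerivAt 𝓘(ℝ, E) 𝓘(ℝ, F) f p D ↔
      HasFDerivAt (f ∘ (chartAt E p).symm) D (chartAt E p p) := by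
  have hwritten : HasFDerivWithinAt (writtenInExtChartAt 𝓘(ℝ, E) 𝓘(ℝ, F) p f) D
      (Set.range 𝓘(ℝ, E)) (extChartAt 𝓘(ℝ, E) p p) ↔
      HasFDerivAt (f ∘ (chartAt E p).symm) D (chartAt E p p) := by
    simp only [mfld_simps, hasFDerivWithinAt_univ]
    rfl
  refine ⟨fun hf => hwritten.1 hf.2, fun hf => ⟨?_, hwritten.2 hf⟩⟩
  refine (hf.continuousAt.comp ((chartAt E p).continuousAt (mem_chart_source E p))).congr ?_
  filter_upwards [(chartAt E p).eventually_left_inverse (mem_chart_source E p)] with q hq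
  exact congrArg f hq

theorem fderiv_comp_chartAt_symm_eq_mvfderiv {f : M → F} {p : M}
    (hf : MDifferentiableAt 𝓘(ℝ, E) 𝓘(ℝ, F) f p) :
    fderiv ℝ (f ∘ (chartAt E p).symm) (chartAt E p p) = mvfderiv 𝓘(ℝ, E) f p :=
  (hasMFDerivAt_iff_hasFDerivAt_chart.1 hf.hasMFDerivAt).fderiv

theorem mvfderiv_comp_of_differentiableAt {F' : Type*} [NormedAddCommGroup F'] [NormedSpace ℝ F']
    {f : M → F} {g : F → F'} {p : M}
    (hg : DifferentiableAt ℝ g (f p)) (hf : MDifferentiableAt 𝓘(ℝ, E) 𝓘(ℝ, F) f p) :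
    mvfderiv 𝓘(ℝ, E) (fun q => g (f q)) p = fderiv ℝ g (f p) ∘L mvfderiv 𝓘(ℝ, E) f p :=
  (mfderiv_comp p hg.mdifferentiableAt hf).trans (congrArg (· ∘L _) mfderiv_eq_fderiv)

theorem fderiv_mvfderiv_eq_zero_of_comp_eq_const {F' : Type*} [NormedAddCommGroup F']
    [NormedSpace ℝ F'] {f : M → F} {g : F → F'} {p : M} {c : F'} (hg : DifferentiableAt ℝ g (f p))
    (hf : MDifferentiableAt 𝓘(ℝ, E) 𝓘(ℝ, F) f p) (hc : ∀ q, g (f q) = c)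
    (X : TangentSpace 𝓘(ℝ, E) p) : fderiv ℝ g (f p) (mvfderiv 𝓘(ℝ, E) f p X) = 0 := by
  have hcomp := mvfderiv_comp_of_differentiableAt hg hf
  simp only [hc, mvfderiv_const] at hcomp
  exact (DFunLike.congr_fun hcomp X).symm

theorem mvfderiv_smul_add_const {f : M → F} {p : M} (hf : MDifferentiableAt 𝓘(ℝ, E) 𝓘(ℝ, F) f p)
    (a : ℝ) (b : F) :
    mvfderiv 𝓘(ℝ, E) (fun q => a • f q + b) p = a • mvfderiv 𝓘(ℝ, E) f p := by
  have haffine : HasFDerivAt (fun v : F => a • v + b) (a • ContinuousLinearMap.id ℝ F) (f p) :=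
    ((hasFDerivAt_id _).const_smul a).add_const b
  have hcomp := mvfderiv_comp_of_differentiableAt haffine.differentiableAt hf
  rwa [haffine.fderiv] at hcomp

theorem differentiableAt_comp_chartAt_symm [IsManifold 𝓘(ℝ, E) 1 M] {f : M → F} (p : M) {x : E}
    (hf : MDifferentiableAt 𝓘(ℝ, E) 𝓘(ℝ, F) f ((chartAt E p).symm x))
    (hx : x ∈ (chartAt E p).target) : DifferentiableAt ℝ (f ∘ (chartAt E p).symm) x :=
  mdifferentiableAt_iff_differentiableAt.1 <|
    hf.comp x ((mdifferentiable_chart (I := 𝓘(ℝ, E)) p).symm.mdifferentiableAt hx)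

theorem fderiv_comp_chartAt_symm_apply [IsManifold 𝓘(ℝ, E) 1 M] {f : M → F} (p : M) {x : E}
    (hf : MDifferentiableAt 𝓘(ℝ, E) 𝓘(ℝ, F) f ((chartAt E p).symm x))
    (hx : x ∈ (chartAt E p).target) (v : E) :
    fderiv ℝ (f ∘ (chartAt E p).symm) x v = mvfderiv 𝓘(ℝ, E) f ((chartAt E p).symm x)
      (mfderiv 𝓘(ℝ, E) 𝓘(ℝ, E) (chartAt E p).symm x v) := by
  rw [← mfderiv_eq_fderiv]
  exact mfderiv_comp_apply x hf
    ((mdifferentiable_chart (I := 𝓘(ℝ, E)) p).symm.mdifferentiableAt hx) v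

theorem contDiffAt_comp_chartAt_symm {n : ℕ∞ω} [IsManifold 𝓘(ℝ, E) n M] {f : M → F}
    (hf : ContMDiff 𝓘(ℝ, E) 𝓘(ℝ, F) n f) (p : M) :
    ContDiffAt ℝ n (f ∘ (chartAt E p).symm) (chartAt E p p) :=
  (hf.comp_contMDiffOn (contMDiffOn_chart_symm (I := 𝓘(ℝ, E)))).contDiffOn.contDiffAt
    (chart_target_mem_nhds E p)

theorem apply_eq_of_mvfderiv_eq_zero [PreconnectedSpace M] [IsManifold 𝓘(ℝ, E) 1 M] {f : M → F}
    (hf : MDifferentiable 𝓘(ℝ, E) 𝓘(ℝ, F) f) (hzero : ∀ p, mvfderiv 𝓘(ℝ, E) f p = 0) (p q : M) :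
    f p = f q := by
  suffices hloc : IsLocallyConstant f from hloc.apply_eq_of_preconnectedSpace p q
  rw [IsLocallyConstant.iff_eventually_eq]
  intro p
  have hderiv : ∀ x ∈ (chartAt E p).target, fderiv ℝ (f ∘ (chartAt E p).symm) x = 0 := by
    intro x hx
    ext v
    rw [fderiv_comp_chartAt_symm_apply p (hf _) hx, hzero]
    rfl
  obtain ⟨ε, hε, hball⟩ := Metric.mem_nhds_iff.1 (chart_target_mem_nhds E p)
  have hchart := (chartAt E p).continuousAt (mem_chart_source E p)
  filter_upwards [hchart.eventually (Metric.ball_mem_nhds _ hε), chart_source_mem_nhds E p]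
    with q hq hqs
  have heq := Metric.isOpen_ball.is_const_of_fderiv_eq_zero (convex_ball _ ε).isPreconnected
    (fun x hx => (differentiableAt_comp_chartAt_symm p (hf _) (hball hx)).differentiableWithinAt)
    (fun x hx => hderiv x (hball hx)) hq (Metric.mem_ball_self hε)
  simpa [(chartAt E p).left_inv hqs] using heq

variable [IsManifold 𝓘(ℝ, E) 2 M]

theorem exists_eq_smul_add_of_mvfderiv_eq_smul [ConnectedSpace M] (hE : 1 < Module.rank ℝ E)
    {r T : M → F} {h : M → ℝ} (hr : ContMDiff 𝓘(ℝ, E) 𝓘(ℝ, F) 2 r)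
    (hT : ContMDiff 𝓘(ℝ, E) 𝓘(ℝ, F) 2 T)
    (hinj : ∀ p, Function.Injective (mvfderiv 𝓘(ℝ, E) r p))
    (hTr : ∀ p, mvfderiv 𝓘(ℝ, E) T p = h p • mvfderiv 𝓘(ℝ, E) r p) :
    ∃ (a : ℝ) (b : F), ∀ p, h p = a ∧ T p = a • r p + b := by
  have : IsManifold 𝓘(ℝ, E) 1 M := .of_le one_le_two
  have hr' := hr.mdifferentiable two_ne_zero
  have hT' := hT.mdifferentiable two_ne_zero
  have hh (p : M) : HasMFDerivAt 𝓘(ℝ, E) 𝓘(ℝ, ℝ) h p 0 := by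
    refine hasMFDerivAt_iff_hasFDerivAt_chart.2 <| hasFDerivAt_zero_of_fderiv_eq_smul hE
      (contDiffAt_comp_chartAt_symm hr p) (contDiffAt_comp_chartAt_symm hT p) ?_ ?_
    · rw [fderiv_comp_chartAt_symm_eq_mvfderiv (hr' p)]
      exact hinj p
    · filter_upwards [chart_target_mem_nhds E p] with x hx
      ext v
      rw [fderiv_comp_chartAt_symm_apply p (hT' _) hx, hTr]
      exact congrArg _ (fderiv_comp_chartAt_symm_apply p (hr' _) hx v).symm
  obtain ⟨p₀⟩ := (inferInstance : Nonempty M)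
  have hconst (p : M) : h p = h p₀ := apply_eq_of_mvfderiv_eq_zero
    (fun p => (hh p).mdifferentiableAt) (fun p => (hh p).mfderiv) p p₀
  have hdiff (p : M) : T p - h p₀ • r p = T p₀ - h p₀ • r p₀ := by
    refine apply_eq_of_mvfderiv_eq_zero (hT'.sub (hr'.const_smul (h p₀))) (fun p => ?_) p p₀
    have hsmul : mvfderiv 𝓘(ℝ, E) (h p₀ • r) p = h p₀ • mvfderiv 𝓘(ℝ, E) r p :=
      const_smul_mfderiv (hr' p) (h p₀)
    refine (mvfderiv_sub (hT' p) ((hr' p).const_smul (h p₀))).trans ?_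
    rw [hsmul, hTr, hconst, sub_self]
  exact ⟨h p₀, T p₀ - h p₀ • r p₀, fun p => ⟨hconst p, by rw [← hdiff p]; abel⟩⟩

end Manifold

theorem inner_mvfderiv_symm_of_inner_eq_zero {E F : Type*} [NormedAddCommGroup E] [NormedSpace ℝ E]
    [NormedAddCommGroup F] [InnerProductSpace ℝ F] {M : Type*} [TopologicalSpace M]
    [ChartedSpace E M] [IsManifold 𝓘(ℝ, E) 2 M] {r N : M → F}
    (hr : ContMDiff 𝓘(ℝ, E) 𝓘(ℝ, F) 2 r) (hN : MDifferentiable 𝓘(ℝ, E) 𝓘(ℝ, F) N)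
    (hrN : ∀ p X, inner ℝ (mvfderiv 𝓘(ℝ, E) r p X) (N p) = 0) (p : M)
    (X Y : TangentSpace 𝓘(ℝ, E) p) :
    inner ℝ (mvfderiv 𝓘(ℝ, E) r p X) (mvfderiv 𝓘(ℝ, E) N p Y) =
      inner ℝ (mvfderiv 𝓘(ℝ, E) r p Y) (mvfderiv 𝓘(ℝ, E) N p X) := by
  have : IsManifold 𝓘(ℝ, E) 1 M := .of_le one_le_two
  have hr' := hr.mdifferentiable two_ne_zero
  have hN' := (hasMFDerivAt_iff_hasFDerivAt_chart.1 (hN p).hasMFDerivAt).differentiableAt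
  rw [← fderiv_comp_chartAt_symm_eq_mvfderiv (hr' p), ← fderiv_comp_chartAt_symm_eq_mvfderiv (hN p)]
  refine inner_fderiv_symm_of_inner_eq_zero (contDiffAt_comp_chartAt_symm hr p) hN' ?_ X Y
  filter_upwards [chart_target_mem_nhds E p] with x hx v
  rw [fderiv_comp_chartAt_symm_apply p (hr' _) hx]
  exact hrN _ _

section ScaledReflection

variable {K V : Type*} [Field K] [AddCommGroup V] [Module K V]

/-- `B u u` times the reflection which fixes `u` and is `-1` on the orthogonal complement of `u`.
The factor makes the definition meaningful for isotropic `u` as well. -/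
def scaledReflection (B : LinearMap.BilinForm K V) (u : V) : Module.End K V :=
  (2 : K) • (B.flip u).smulRight u - B u u • 1

theorem scaledReflection_apply (B : LinearMap.BilinForm K V) (u x : V) :
    scaledReflection B u x = (2 * B x u) • u - B u u • x := by
  simp [scaledReflection, mul_smul]

theorem scaledReflection_self (B : LinearMap.BilinForm K V) (u : V) :
    scaledReflection B u u = B u u • u := by
  rw [scaledReflection_apply]
  module

variable {B : LinearMap.BilinForm K V} {u : V}

theorem trace_scaledReflection (hV : Module.finrank K V = 2) :
    LinearMap.trace K V (scaledReflection B u) = 0 := by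
  have : FiniteDimensional K V := Module.finite_of_finrank_eq_succ hV
  simp [scaledReflection, hV, mul_comm]

theorem exists_basis_orthogonal (hV : Module.finrank K V = 2) (hu : B u u ≠ 0) :
    ∃ b : Module.Basis (Fin 2) K V, b 0 = u ∧ B (b 1) u = 0 := by
  have : FiniteDimensional K V := Module.finite_of_finrank_eq_succ hV
  have hker : LinearMap.ker (B.flip u) ≠ ⊥ := LinearMap.ker_ne_bot_of_finrank_lt (by simp [hV])
  obtain ⟨w, hwu, hw⟩ := (Submodule.ne_bot_iff _).1 hker
  replace hwu : B w u = 0 := by simpa using hwu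
  have hli : LinearIndependent K ![u, w] := by
    rw [LinearIndependent.pair_symm_iff, LinearIndependent.pair_iff' hw]
    rintro t rfl
    exact hu (by rw [LinearMap.BilinForm.smul_left, hwu, mul_zero])
  exact ⟨basisOfLinearIndependentOfCardEqFinrank hli (by simp [hV]), by simp, by simpa using hwu⟩

theorem apply_eq_neg_smul_of_trace_eq_zero (b : Module.Basis (Fin 2) K V) {A : Module.End K V}
    (hA : ∀ x y, B (A x) y = B x (A y)) (hb : B (b 0) (b 0) ≠ 0) (hb' : B (b 1) (b 0) = 0)
    (htr : LinearMap.trace K V A = 0) {κ : K} (hκ : A (b 0) = κ • b 0) :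
    A (b 1) = -κ • b 1 := by
  have hrepr : A (b 1) = b.repr (A (b 1)) 0 • b 0 + b.repr (A (b 1)) 1 • b 1 := by
    rw [← Fin.sum_univ_two fun i => b.repr (A (b 1)) i • b i, b.sum_repr]
  have hzero : b.repr (A (b 1)) 0 = 0 := by
    have hB := hA (b 1) (b 0)
    rw [hκ, hrepr] at hB
    simpa [hb, hb'] using hB
  have hsum : κ + b.repr (A (b 1)) 1 = 0 := by
    simpa [LinearMap.trace_eq_matrix_trace K b, Matrix.trace_fin_two, LinearMap.toMatrix_apply,
      hκ] using htr
  rw [hrepr, hzero, eq_neg_of_add_eq_zero_right hsum, zero_smul, zero_add]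

theorem trace_eq_zero_and_hasEigenvector_iff (hV : Module.finrank K V = 2) (hu : B u u ≠ 0)
    {A : Module.End K V} (hA : ∀ x y, B (A x) y = B x (A y)) {κ : K} :
    (LinearMap.trace K V A = 0 ∧ A.HasEigenvector κ u) ↔
      A = (κ / B u u) • scaledReflection B u := by
  constructor
  · rintro ⟨htr, hκ⟩
    obtain ⟨b, rfl, hb⟩ := exists_basis_orthogonal hV hu
    have hA₁ := apply_eq_neg_smul_of_trace_eq_zero b hA hu hb htr hκ.apply_eq_smul
    refine b.ext (Fin.forall_fin_two.2 ⟨?_, ?_⟩)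
    · rw [hκ.apply_eq_smul, LinearMap.smul_apply, scaledReflection_self, smul_smul,
        div_mul_cancel₀ _ hu]
    · rw [hA₁, LinearMap.smul_apply, scaledReflection_apply, hb, mul_zero, zero_smul, zero_sub,
        smul_neg, smul_smul, div_mul_cancel₀ _ hu, neg_smul]
  · rintro rfl
    refine ⟨by rw [map_smul, trace_scaledReflection hV, smul_zero], ?_, ?_⟩
    · rw [Module.End.mem_eigenspace_iff, LinearMap.smul_apply, scaledReflection_self, smul_smul,
        div_mul_cancel₀ _ hu]
    · rintro rfl
      simp at hu

end ScaledReflection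

section Artanh

open Real

theorem eventuallyEq_artanh_half_log {x : ℝ} (hx : x ^ 2 < 1) :
    artanh =ᶠ[nhds x] fun y => 1 / 2 * log ((1 + y) / (1 - y)) := by
  filter_upwards [Ioo_mem_nhds (abs_lt.1 ((sq_lt_one_iff_abs_lt_one x).1 hx)).1
    (abs_lt.1 ((sq_lt_one_iff_abs_lt_one x).1 hx)).2] with y hy
  exact artanh_eq_half_log (Set.Ioo_subset_Icc_self hy)

theorem contDiffAt_artanh {n : ℕ∞ω} {x : ℝ} (hx : x ^ 2 < 1) : ContDiffAt ℝ n artanh x := by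
  have hadd : 1 + x ≠ 0 := by nlinarith
  have hsub : 1 - x ≠ 0 := by nlinarith
  refine ContDiffAt.congr_of_eventuallyEq ?_ (eventuallyEq_artanh_half_log hx)
  exact contDiffAt_const.mul <| ((contDiffAt_const.add contDiffAt_id).div
    (contDiffAt_const.sub contDiffAt_id) hsub).log (div_ne_zero hadd hsub)

theorem hasDerivAt_artanh {x : ℝ} (hx : x ^ 2 < 1) : HasDerivAt artanh (1 - x ^ 2)⁻¹ x := by
  have hadd : 1 + x ≠ 0 := by nlinarith
  have hsub : 1 - x ≠ 0 := by nlinarith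
  have hderiv := ((((hasDerivAt_id' x).const_add 1).fun_div ((hasDerivAt_id' x).const_sub 1)
    hsub).log (div_ne_zero hadd hsub)).const_mul (1 / 2 : ℝ)
  refine (hderiv.congr_of_eventuallyEq (eventuallyEq_artanh_half_log hx)).congr_deriv ?_
  rw [show 1 - x ^ 2 = (1 + x) * (1 - x) by ring]
  field_simp
  ring

end Artanh

section UnitCatenoid

open Real

variable {F : Type*} [NormedAddCommGroup F] [InnerProductSpace ℝ F]

/-- The catenoid of size `1` around the line `ℝ k`, where `k` is a unit vector: the points whose
distance from the axis is the hyperbolic cosine of their height. -/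
def unitCatenoid (k : F) : Set F :=
  {v | ‖v‖ ^ 2 - inner ℝ v k ^ 2 = cosh (inner ℝ v k) ^ 2}

/-- The Gauss map of `unitCatenoid k`, extended to the whole space by its formula. -/
noncomputable def unitCatenoidNormal (k v : F) : F :=
  (cosh (inner ℝ v k) ^ 2)⁻¹ •
    (v - (inner ℝ v k + cosh (inner ℝ v k) * sinh (inner ℝ v k)) • k)

/-- The inverse of the Gauss map of `unitCatenoid k`: the point with the given unit normal. It is
meaningful for unit vectors different from `± k`. -/
noncomputable def unitCatenoidOfNormal (k v : F) : F :=
  (1 - inner ℝ v k ^ 2)⁻¹ • (v - inner ℝ v k • k) - artanh (inner ℝ v k) • k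

variable {k v : F}

theorem neg_mem_unitCatenoid : -v ∈ unitCatenoid k ↔ v ∈ unitCatenoid k := by
  simp [unitCatenoid]

theorem unitCatenoid_neg (k : F) : unitCatenoid (-k) = unitCatenoid k := by
  simp [unitCatenoid]

theorem map_mem_unitCatenoid_iff {F' : Type*} [NormedAddCommGroup F'] [InnerProductSpace ℝ F']
    (L : F →ₗᵢ[ℝ] F') : L v ∈ unitCatenoid (L k) ↔ v ∈ unitCatenoid k := by
  simp [unitCatenoid]

theorem unitCatenoidNormal_neg (k v : F) :
    unitCatenoidNormal k (-v) = -unitCatenoidNormal k v := by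
  simp only [unitCatenoidNormal, inner_neg_left, cosh_neg, sinh_neg]
  module

theorem continuous_unitCatenoidNormal (k : F) : Continuous (unitCatenoidNormal k) :=
  ((by fun_prop : Continuous fun v => cosh (inner ℝ v k) ^ 2).inv₀ fun v => by positivity).smul
    (by fun_prop)

theorem inner_unitCatenoidNormal (hk : ‖k‖ = 1) (v : F) :
    inner ℝ (unitCatenoidNormal k v) k = -tanh (inner ℝ v k) := by
  have hcosh := (cosh_pos (inner ℝ v k)).ne'
  rw [unitCatenoidNormal, real_inner_smul_left, inner_sub_left, real_inner_smul_left,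
    real_inner_self_eq_norm_sq, hk, tanh_eq_sinh_div_cosh]
  field_simp
  ring

theorem one_sub_inner_unitCatenoidNormal_sq (hk : ‖k‖ = 1) (v : F) :
    1 - inner ℝ (unitCatenoidNormal k v) k ^ 2 = (cosh (inner ℝ v k) ^ 2)⁻¹ := by
  have hcosh := (cosh_pos (inner ℝ v k)).ne'
  rw [inner_unitCatenoidNormal hk, tanh_eq_sinh_div_cosh]
  field_simp
  linarith [cosh_sq (inner ℝ v k)]

theorem norm_unitCatenoidNormal (hk : ‖k‖ = 1) (hv : v ∈ unitCatenoid k) :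
    ‖unitCatenoidNormal k v‖ = 1 := by
  have hcosh := (cosh_pos (inner ℝ v k)).ne'
  have hnorm : ‖v‖ ^ 2 = inner ℝ v k ^ 2 + cosh (inner ℝ v k) ^ 2 := by
    rw [← hv.out]
    ring
  rw [← sq_eq_sq₀ (norm_nonneg _) zero_le_one, unitCatenoidNormal, norm_smul, mul_pow,
    norm_sub_sq_real, norm_smul, mul_pow, hk, real_inner_smul_right, hnorm, Real.norm_eq_abs,
    Real.norm_eq_abs, sq_abs, sq_abs]
  field_simp
  linear_combination (-cosh (inner ℝ v k) ^ 2) * cosh_sq (inner ℝ v k)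

theorem unitCatenoidOfNormal_unitCatenoidNormal (hk : ‖k‖ = 1) (v : F) :
    unitCatenoidOfNormal k (unitCatenoidNormal k v) = v := by
  have hcosh := (cosh_pos (inner ℝ v k)).ne'
  rw [unitCatenoidOfNormal, one_sub_inner_unitCatenoidNormal_sq hk, inner_unitCatenoidNormal hk,
    ← tanh_neg, artanh_tanh, tanh_neg, tanh_eq_sinh_div_cosh, unitCatenoidNormal]
  match_scalars <;> field_simp
  ring

theorem hasFDerivAt_inner_const (k v : F) :
    HasFDerivAt (fun w => inner ℝ w k) (innerSL ℝ k) v :=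
  (innerSL ℝ k).hasFDerivAt.congr_of_eventuallyEq (.of_forall fun w => real_inner_comm k w)

theorem hasFDerivAt_unitCatenoid_equation (k v : F) :
    HasFDerivAt (fun w => ‖w‖ ^ 2 - inner ℝ w k ^ 2 - cosh (inner ℝ w k) ^ 2)
      ((2 * cosh (inner ℝ v k) ^ 2) • innerSL ℝ (unitCatenoidNormal k v)) v := by
  have hcosh := (cosh_pos (inner ℝ v k)).ne'
  have hinner := hasFDerivAt_inner_const k v
  refine (((hasStrictFDerivAt_norm_sq v).hasFDerivAt.fun_sub (hinner.pow 2)).fun_sub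
    (hinner.cosh.pow 2)).congr_fderiv ?_
  rw [unitCatenoidNormal, map_smul, map_sub, map_smul]
  match_scalars <;> field_simp
  ring

theorem inner_unitCatenoidOfNormal (hk : ‖k‖ = 1) (v : F) :
    inner ℝ (unitCatenoidOfNormal k v) k = -artanh (inner ℝ v k) := by
  rw [unitCatenoidOfNormal, inner_sub_left, real_inner_smul_left, inner_sub_left,
    real_inner_smul_left, real_inner_smul_left, real_inner_self_eq_norm_sq, hk]
  ring

theorem unitCatenoidOfNormal_mem (hk : ‖k‖ = 1) (hv : ‖v‖ = 1) (hvk : inner ℝ v k ^ 2 < 1) :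
    unitCatenoidOfNormal k v ∈ unitCatenoid k := by
  have hpos : 0 < 1 - inner ℝ v k ^ 2 := sub_pos.2 hvk
  have hcosh : cosh (artanh (inner ℝ v k)) ^ 2 = (1 - inner ℝ v k ^ 2)⁻¹ := by
    rw [cosh_artanh (abs_lt.1 ((sq_lt_one_iff_abs_lt_one _).1 hvk)), div_pow, sq_sqrt hpos.le,
      one_pow, one_div]
  have hhorizontal : ‖v - inner ℝ v k • k‖ ^ 2 = 1 - inner ℝ v k ^ 2 := by
    rw [norm_sub_sq_real, norm_smul, mul_pow, hv, hk, real_inner_smul_right, Real.norm_eq_abs,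
      sq_abs]
    ring
  have horth : inner ℝ (v - inner ℝ v k • k) k = 0 := by
    rw [inner_sub_left, real_inner_smul_left, real_inner_self_eq_norm_sq, hk]
    ring
  rw [unitCatenoid, Set.mem_ofPred, inner_unitCatenoidOfNormal hk, cosh_neg, hcosh,
    unitCatenoidOfNormal, norm_sub_sq_real, norm_smul, norm_smul, mul_pow, mul_pow, hhorizontal, hk,
    real_inner_smul_left, real_inner_smul_right, horth, Real.norm_eq_abs, Real.norm_eq_abs, sq_abs,
    sq_abs]
  field_simp
  ring

theorem contDiffAt_unitCatenoidOfNormal {n : ℕ∞ω} (hvk : inner ℝ v k ^ 2 < 1) :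
    ContDiffAt ℝ n (unitCatenoidOfNormal k) v := by
  have hinner : ContDiffAt ℝ n (fun w => inner ℝ w k) v := contDiffAt_id.inner ℝ contDiffAt_const
  exact (((contDiffAt_const.sub (hinner.pow 2)).inv (sub_pos.2 hvk).ne').smul
    (contDiffAt_id.sub (hinner.smul contDiffAt_const))).sub
      (((contDiffAt_artanh hvk).comp v hinner).smul contDiffAt_const)

theorem fderiv_unitCatenoidOfNormal_apply (hvk : inner ℝ v k ^ 2 < 1) (w : F) :
    fderiv ℝ (unitCatenoidOfNormal k) v w = (1 - inner ℝ v k ^ 2)⁻¹ •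
      (w + (2 * inner ℝ v k * inner ℝ w k / (1 - inner ℝ v k ^ 2)) • (v - inner ℝ v k • k) -
        (2 * inner ℝ w k) • k) := by
  have hpos : 1 - inner ℝ v k ^ 2 ≠ 0 := (sub_pos.2 hvk).ne'
  have hinner := hasFDerivAt_inner_const k v
  have hscale : HasFDerivAt (fun x => (1 - inner ℝ x k ^ 2)⁻¹) _ v :=
    (hasDerivAt_inv hpos).comp_hasFDerivAt (f := fun x => 1 - inner ℝ x k ^ 2) v
      ((hinner.pow 2).const_sub 1)
  have hheight : HasFDerivAt (fun x => artanh (inner ℝ x k)) _ v :=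
    (hasDerivAt_artanh hvk).comp_hasFDerivAt (h₂ := artanh) v hinner
  have hderiv : HasFDerivAt (unitCatenoidOfNormal k) _ v :=
    (hscale.fun_smul ((hasFDerivAt_id v).fun_sub (hinner.smul_const k))).fun_sub
      (hheight.smul_const k)
  rw [hderiv.fderiv]
  simp only [Nat.add_one_sub_one, pow_one, nsmul_eq_mul, Nat.cast_ofNat, smul_neg, neg_smul,
    neg_neg, id_eq, sub_apply, add_apply, smul_apply, ContinuousLinearMap.id_apply,
    ContinuousLinearMap.smulRight_apply, coe_innerSL_apply, smul_eq_mul, real_inner_comm w k]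
  match_scalars <;> field_simp
  ring

theorem fderiv_unitCatenoidOfNormal_apply_eq_iff (hk : ‖k‖ = 1) (hvk : inner ℝ v k ^ 2 < 1)
    {w s : F} :
    fderiv ℝ (unitCatenoidOfNormal k) v w = s ↔
      w = (1 - inner ℝ v k ^ 2) • s - (2 * inner ℝ s k) • (k - inner ℝ v k • v) := by
  have hpos : 1 - inner ℝ v k ^ 2 ≠ 0 := (sub_pos.2 hvk).ne'
  have hkk : inner ℝ k k = 1 := by rw [real_inner_self_eq_norm_sq, hk, one_pow]
  rw [fderiv_unitCatenoidOfNormal_apply hvk]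
  constructor
  · rintro rfl
    simp only [real_inner_smul_left, inner_sub_left, inner_add_left, hkk]
    match_scalars <;> field_simp <;> ring
  · intro hw
    have hwk : inner ℝ w k = -((1 - inner ℝ v k ^ 2) * inner ℝ s k) := by
      rw [hw]
      simp only [real_inner_smul_left, inner_sub_left, hkk]
      ring
    rw [hwk, hw]
    match_scalars <;> field_simp <;> ring

end UnitCatenoid

section Catenoid

theorem inv_smul_mem_unitCatenoid_iff {c : ℝ} (hc : c ≠ 0) {v : E3} :
    c⁻¹ • v ∈ unitCatenoid (EuclideanSpace.single 2 1 : E3) ↔ v ∈ catenoid c := by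
  have hheight : inner ℝ (c⁻¹ • v) (EuclideanSpace.single 2 1) = v 2 / c := by
    simp [EuclideanSpace.inner_single_right, div_eq_inv_mul]
  have hdist : ‖c⁻¹ • v‖ ^ 2 - (v 2 / c) ^ 2 = (v 0 ^ 2 + v 1 ^ 2) / c ^ 2 := by
    rw [EuclideanSpace.real_norm_sq_eq, Fin.sum_univ_three]
    simp only [PiLp.smul_apply, smul_eq_mul]
    ring
  rw [unitCatenoid, Set.mem_ofPred, hheight, hdist, catenoid, Set.mem_ofPred, mul_pow,
    div_eq_iff (pow_ne_zero 2 hc), mul_comm]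

theorem mem_image_catenoid_iff {c : ℝ} (hc : c ≠ 0) {Φ : E3 ≃ᵃⁱ[ℝ] E3} {k : E3}
    (hΦ : CarriesAxisTo Φ k) {q : E3} :
    q ∈ Φ '' catenoid c ↔ c⁻¹ • (q - Φ 0) ∈ unitCatenoid k := by
  obtain ⟨v, rfl⟩ := Φ.surjective q
  have haxis : unitCatenoid k =
      unitCatenoid (Φ.linearIsometryEquiv (EuclideanSpace.single 2 1)) := by
    rcases hΦ with hΦ | hΦ <;> simp only [hΦ, unitCatenoid_neg]
  have hlinear : Φ v - Φ 0 = Φ.linearIsometryEquiv v := by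
    simpa using (Φ.map_vsub v 0).symm
  rw [Φ.injective.mem_set_image, haxis, hlinear, ← map_smul, ← inv_smul_mem_unitCatenoid_iff hc]
  exact (map_mem_unitCatenoid_iff Φ.linearIsometryEquiv.toLinearIsometry).symm

theorem exists_affineIsometryEquiv_carriesAxisTo {k : E3} (hk : ‖k‖ = 1) (b : E3) :
    ∃ Φ : E3 ≃ᵃⁱ[ℝ] E3, Φ 0 = b ∧ CarriesAxisTo Φ k := by
  let e : E3 := EuclideanSpace.single 2 1
  have hreflection : (ℝ ∙ (e - k))ᗮ.reflection e = k := Submodule.reflection_sub (by simp [e, hk])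
  exact ⟨(ℝ ∙ (e - k))ᗮ.reflection.toAffineIsometryEquiv.trans (.constVAdd ℝ E3 b), by simp,
    Or.inl hreflection⟩

end Catenoid

theorem inner_mvfderiv_unitCatenoidNormal {E F : Type*} [NormedAddCommGroup E] [NormedSpace ℝ E]
    [NormedAddCommGroup F] [InnerProductSpace ℝ F] {M : Type*} [TopologicalSpace M]
    [ChartedSpace E M] {f : M → F} {k : F} (hf : ∀ q, f q ∈ unitCatenoid k) {p : M}
    (hfp : MDifferentiableAt 𝓘(ℝ, E) 𝓘(ℝ, F) f p) (X : TangentSpace 𝓘(ℝ, E) p) :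
    inner ℝ (mvfderiv 𝓘(ℝ, E) f p X) (unitCatenoidNormal k (f p)) = 0 := by
  have hX := fderiv_mvfderiv_eq_zero_of_comp_eq_const
    (hasFDerivAt_unitCatenoid_equation k (f p)).differentiableAt hfp
    (fun q => sub_eq_zero.2 (hf q).out) X
  rw [(hasFDerivAt_unitCatenoid_equation k (f p)).fderiv, smul_apply, innerSL_apply_apply] at hX
  rw [real_inner_comm]
  exact (mul_eq_zero.1 hX).resolve_left (by positivity)

namespace ImmersedSurface

variable {M : Type*} [TopologicalSpace M] [ChartedSpace (EuclideanSpace ℝ (Fin 2)) M]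
  (S : ImmersedSurface M) {k : E3} {p : M}

theorem mdifferentiable_r : MDifferentiable (𝓡 2) 𝓘(ℝ, E3) S.r :=
  S.r_smooth.mdifferentiable (by simp)

theorem mdifferentiable_N : MDifferentiable (𝓡 2) 𝓘(ℝ, E3) S.N :=
  S.N_smooth.mdifferentiable (by simp)

theorem finrank_tangentSpace (p : M) : Module.finrank ℝ (TangentSpace (𝓡 2) p) = 2 :=
  finrank_euclideanSpace_fin

theorem range_ambientDeriv_r (p : M) :
    LinearMap.range (ambientDeriv S.r p) = (ℝ ∙ S.N p)ᗮ := by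
  have : FiniteDimensional ℝ (TangentSpace (𝓡 2) p) :=
    Module.finite_of_finrank_eq_succ (finrank_tangentSpace p)
  have hle : LinearMap.range (ambientDeriv S.r p) ≤ (ℝ ∙ S.N p)ᗮ := by
    rintro _ ⟨X, rfl⟩
    exact Submodule.mem_orthogonal_singleton_iff_inner_left.2 (S.N_normal p X)
  have hN : S.N p ≠ 0 := norm_ne_zero_iff.1 (S.N_unit p ▸ one_ne_zero)
  refine Submodule.eq_of_le_of_finrank_eq hle ?_
  have : Fact (Module.finrank ℝ E3 = 2 + 1) := ⟨finrank_euclideanSpace_fin⟩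
  rw [LinearMap.finrank_range_of_inj (S.r_immersion p), finrank_tangentSpace,
    Submodule.finrank_orthogonal_span_singleton (n := 2) hN]

theorem ambientDeriv_tangentPart (p : M) (v : E3) :
    ambientDeriv S.r p (S.tangentPart p v) = v - inner ℝ (S.N p) v • S.N p := by
  have hproj : ambientDeriv S.r p (S.tangentPart p v) =
      (LinearMap.range (ambientDeriv S.r p)).starProjection v :=
    congrArg Subtype.val <| LinearEquiv.apply_symm_apply
      (LinearEquiv.ofInjective (ambientDeriv S.r p) (S.r_immersion p)) _
  simp only [hproj, S.range_ambientDeriv_r, Submodule.starProjection_orthogonal_val,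
    Submodule.starProjection_unit_singleton ℝ (S.N_unit p)]

theorem ambientDeriv_U (k : E3) (p : M) :
    ambientDeriv S.r p (S.U k p) = k - inner ℝ (S.N p) k • S.N p :=
  S.ambientDeriv_tangentPart p k

theorem inner_ambientDeriv_N (p : M) (X : TangentSpace (𝓡 2) p) :
    inner ℝ (S.N p) (ambientDeriv S.N p X) = 0 := by
  have hX := fderiv_mvfderiv_eq_zero_of_comp_eq_const (g := fun v : E3 => ‖v‖ ^ 2)
    (hasStrictFDerivAt_norm_sq (S.N p)).hasFDerivAt.differentiableAt (S.mdifferentiable_N p)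
    (fun q => by rw [S.N_unit]) X
  rw [(hasStrictFDerivAt_norm_sq _).hasFDerivAt.fderiv, smul_apply] at hX
  exact (smul_eq_zero.1 hX).resolve_left two_ne_zero

theorem ambientDeriv_shapeOperator (p : M) (X : TangentSpace (𝓡 2) p) :
    ambientDeriv S.r p (S.shapeOperator p X) = -ambientDeriv S.N p X := by
  have htangent := S.ambientDeriv_tangentPart p (ambientDeriv S.N p X)
  rw [S.inner_ambientDeriv_N, zero_smul, sub_zero] at htangent
  exact (map_neg _ _).trans (congrArg Neg.neg htangent)

/-- The induced metric (first fundamental form) at `p`. -/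
noncomputable def metric (p : M) : LinearMap.BilinForm ℝ (TangentSpace (𝓡 2) p) :=
  (innerₗ E3).compl₁₂ (ambientDeriv S.r p) (ambientDeriv S.r p)

theorem metric_apply (p : M) (X Y : TangentSpace (𝓡 2) p) :
    S.metric p X Y = inner ℝ (ambientDeriv S.r p X) (ambientDeriv S.r p Y) :=
  rfl

theorem metric_U (k : E3) (p : M) (X : TangentSpace (𝓡 2) p) :
    S.metric p X (S.U k p) = inner ℝ (ambientDeriv S.r p X) k := by
  rw [metric_apply, S.ambientDeriv_U, inner_sub_right, real_inner_smul_right, S.N_normal, mul_zero,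
    sub_zero]

theorem metric_U_self (hk : ‖k‖ = 1) (p : M) :
    S.metric p (S.U k p) (S.U k p) = 1 - inner ℝ (S.N p) k ^ 2 := by
  rw [S.metric_U, S.ambientDeriv_U, inner_sub_left, real_inner_smul_left,
    real_inner_self_eq_norm_sq, hk]
  ring

theorem metric_U_self_ne_zero (hk : ‖k‖ = 1) (hN : inner ℝ (S.N p) k ^ 2 < 1) :
    S.metric p (S.U k p) (S.U k p) ≠ 0 := by
  rw [S.metric_U_self hk]
  exact (sub_pos.2 hN).ne'

theorem U_ne_zero_iff (hk : ‖k‖ = 1) : S.U k p ≠ 0 ↔ inner ℝ (S.N p) k ^ 2 < 1 := by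
  rw [← sub_pos, ← S.metric_U_self hk, metric_apply, real_inner_self_pos]
  exact (map_ne_zero_iff _ (S.r_immersion p)).symm

theorem metric_shapeOperator_symm [IsManifold (𝓡 2) ∞ M] (p : M) (X Y : TangentSpace (𝓡 2) p) :
    S.metric p (S.shapeOperator p X) Y = S.metric p X (S.shapeOperator p Y) := by
  rw [metric_apply, metric_apply, S.ambientDeriv_shapeOperator, S.ambientDeriv_shapeOperator,
    inner_neg_left, inner_neg_right, real_inner_comm, neg_inj]
  exact inner_mvfderiv_symm_of_inner_eq_zero (S.r_smooth.of_le ENat.LEInfty.out)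
    S.mdifferentiable_N S.N_normal p Y X

theorem ambientDeriv_scaledReflection_U (hk : ‖k‖ = 1) (p : M) (X : TangentSpace (𝓡 2) p) :
    ambientDeriv S.r p (scaledReflection (S.metric p) (S.U k p) X) =
      (2 * inner ℝ (ambientDeriv S.r p X) k) • (k - inner ℝ (S.N p) k • S.N p) -
        (1 - inner ℝ (S.N p) k ^ 2) • ambientDeriv S.r p X := by
  rw [scaledReflection_apply, S.metric_U, S.metric_U_self hk, map_sub, map_smul, map_smul,
    S.ambientDeriv_U]

theorem cos_angle (hk : ‖k‖ = 1) (p : M) : Real.cos (S.angle k p) = inner ℝ (S.N p) k := by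
  rw [angle, InnerProductGeometry.cos_angle, S.N_unit, hk, mul_one, div_one]

theorem angle_eq_arccos (hk : ‖k‖ = 1) (p : M) :
    S.angle k p = Real.arccos (inner ℝ (S.N p) k) := by
  rw [angle, InnerProductGeometry.angle, S.N_unit, hk, mul_one, div_one]

/-- The composition of the Gauss map of the surface with the inverse of the Gauss map of the
unit catenoid around the axis `ℝ k`. -/
noncomputable def catenoidPoint (k : E3) (p : M) : E3 :=
  unitCatenoidOfNormal k (S.N p)

theorem contMDiff_catenoidPoint (hN : ∀ p, inner ℝ (S.N p) k ^ 2 < 1) :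
    ContMDiff (𝓡 2) 𝓘(ℝ, E3) ∞ (S.catenoidPoint k) := fun p =>
  (contDiffAt_unitCatenoidOfNormal (hN p)).contMDiffAt.comp p (S.N_smooth p)

theorem ambientDeriv_catenoidPoint {a : ℝ} {b : E3}
    (hab : ∀ p, S.catenoidPoint k p = a • S.r p + b) (p : M) :
    ambientDeriv (S.catenoidPoint k) p = a • ambientDeriv S.r p := by
  rw [ambientDeriv, funext hab]
  exact congrArg ContinuousLinearMap.toLinearMap
    (mvfderiv_smul_add_const (S.mdifferentiable_r p) a b)

theorem shapeOperator_eq_smul_scaledReflection_iff (hk : ‖k‖ = 1) {a : ℝ}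
    (hN : inner ℝ (S.N p) k ^ 2 < 1) :
    S.shapeOperator p = a • scaledReflection (S.metric p) (S.U k p) ↔
      ambientDeriv (S.catenoidPoint k) p = a • ambientDeriv S.r p := by
  rw [LinearMap.ext_iff, LinearMap.ext_iff]
  refine forall_congr' fun X => ?_
  have hcomp : ambientDeriv (S.catenoidPoint k) p X =
      fderiv ℝ (unitCatenoidOfNormal k) (S.N p) (ambientDeriv S.N p X) :=
    DFunLike.congr_fun (mvfderiv_comp_of_differentiableAt
      ((contDiffAt_unitCatenoidOfNormal hN).differentiableAt one_ne_zero)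
      (S.mdifferentiable_N p)) X
  rw [hcomp, fderiv_unitCatenoidOfNormal_apply_eq_iff hk hN, ← (S.r_immersion p).eq_iff,
    S.ambientDeriv_shapeOperator, neg_eq_iff_eq_neg]
  simp only [LinearMap.smul_apply, map_smul, S.ambientDeriv_scaledReflection_U hk,
    real_inner_smul_left]
  refine Eq.congr_right ?_
  module

variable [IsManifold (𝓡 2) ∞ M]

theorem trace_shapeOperator_eq_zero_and_hasEigenvector_U_iff (hk : ‖k‖ = 1) :
    (LinearMap.trace ℝ _ (S.shapeOperator p) = 0 ∧
        ∃ κ : ℝ, (S.shapeOperator p).HasEigenvector κ (S.U k p)) ↔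
      inner ℝ (S.N p) k ^ 2 < 1 ∧
        ∃ a : ℝ, ambientDeriv (S.catenoidPoint k) p = a • ambientDeriv S.r p := by
  rw [← exists_and_left, ← exists_and_left]
  constructor
  · rintro ⟨κ, htr, hκ⟩
    have hN := (S.U_ne_zero_iff hk).1 hκ.2
    have hU := S.metric_U_self_ne_zero hk hN
    exact ⟨_, hN, (S.shapeOperator_eq_smul_scaledReflection_iff hk hN).1 <|
      (trace_eq_zero_and_hasEigenvector_iff (finrank_tangentSpace p) hU
        (S.metric_shapeOperator_symm p)).1 ⟨htr, hκ⟩⟩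
  · rintro ⟨a, hN, ha⟩
    have hU := S.metric_U_self_ne_zero hk hN
    refine ⟨a * S.metric p (S.U k p) (S.U k p), (trace_eq_zero_and_hasEigenvector_iff
      (finrank_tangentSpace p) hU (S.metric_shapeOperator_symm p)).2 ?_⟩
    rwa [mul_div_cancel_right₀ _ hU, S.shapeOperator_eq_smul_scaledReflection_iff hk hN]

variable [ConnectedSpace M]

theorem isMinimal_and_isPrincipalU_iff (hk : ‖k‖ = 1) :
    S.IsMinimal ∧ S.IsPrincipalU k ↔ (∀ p, inner ℝ (S.N p) k ^ 2 < 1) ∧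
      ∃ (a : ℝ) (b : E3), ∀ p, S.catenoidPoint k p = a • S.r p + b := by
  refine forall_and.symm.trans <| (forall_congr' fun p =>
    S.trace_shapeOperator_eq_zero_and_hasEigenvector_U_iff hk).trans <| forall_and.trans <|
      and_congr_right fun hN => ?_
  constructor
  · intro hderiv
    choose a ha using hderiv
    have hrank : 1 < Module.rank ℝ (EuclideanSpace ℝ (Fin 2)) := by
      simp [rank_eq_card_basis (EuclideanSpace.basisFun (Fin 2) ℝ).toBasis]
    obtain ⟨a₀, b, hab⟩ := exists_eq_smul_add_of_mvfderiv_eq_smul hrank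
      (S.r_smooth.of_le ENat.LEInfty.out) ((S.contMDiff_catenoidPoint hN).of_le ENat.LEInfty.out)
      S.r_immersion fun p => ContinuousLinearMap.coe_injective (ha p)
    exact ⟨a₀, b, fun p => (hab p).2⟩
  · rintro ⟨a, b, hab⟩ p
    exact ⟨a, S.ambientDeriv_catenoidPoint hab p⟩

end ImmersedSurface

namespace ImmersedSurface

variable {M : Type*} [TopologicalSpace M] [ChartedSpace (EuclideanSpace ℝ (Fin 2)) M]
  (S : ImmersedSurface M) {k : E3} {a : ℝ} {b : E3}

section

variable (hN : ∀ p, inner ℝ (S.N p) k ^ 2 < 1)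
  (hab : ∀ p, S.catenoidPoint k p = a • S.r p + b)

include hN hab

theorem shapeOperator_U (hk : ‖k‖ = 1) (p : M) :
    S.shapeOperator p (S.U k p) = (a * (1 - inner ℝ (S.N p) k ^ 2)) • S.U k p := by
  rw [(S.shapeOperator_eq_smul_scaledReflection_iff hk (hN p)).2
    (S.ambientDeriv_catenoidPoint hab p), LinearMap.smul_apply, scaledReflection_self,
    S.metric_U_self hk, smul_smul]

theorem isCanonicalPrincipalU_iff_ne_zero [Nonempty M] (hk : ‖k‖ = 1) :
    S.IsCanonicalPrincipalU k ↔ a ≠ 0 := by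
  constructor
  · rintro hcan rfl
    obtain ⟨p₀⟩ := (inferInstance : Nonempty M)
    obtain ⟨κ, hκ, hU⟩ := hcan p₀
    have hzero : κ • S.U k p₀ = 0 := by
      rw [← hU.apply_eq_smul, S.shapeOperator_U hN hab hk, zero_mul, zero_smul]
    exact hκ ((smul_eq_zero.1 hzero).resolve_right hU.2)
  · exact fun ha p => ⟨_, mul_ne_zero ha (sub_pos.2 (hN p)).ne',
      Module.End.mem_eigenspace_iff.2 (S.shapeOperator_U hN hab hk p),
      (S.U_ne_zero_iff hk).2 (hN p)⟩

theorem inner_ambientDeriv_N_U (hk : ‖k‖ = 1) (p : M) :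
    inner ℝ (ambientDeriv S.N p (S.U k p)) k = -(a * (1 - inner ℝ (S.N p) k ^ 2) ^ 2) := by
  rw [← neg_neg (ambientDeriv S.N p _), ← S.ambientDeriv_shapeOperator, inner_neg_left,
    S.shapeOperator_U hN hab hk, map_smul, real_inner_smul_left, ← S.metric_U, S.metric_U_self hk]
  ring

theorem hasConstantAngle_iff_eq_zero [Nonempty M] (hk : ‖k‖ = 1) :
    S.HasConstantAngle k ↔ a = 0 := by
  obtain ⟨p₀⟩ := (inferInstance : Nonempty M)
  constructor
  · rintro ⟨θ, hθ⟩
    have hderiv := fderiv_mvfderiv_eq_zero_of_comp_eq_const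
      (hasFDerivAt_inner_const k (S.N p₀)).differentiableAt (S.mdifferentiable_N p₀)
      (fun p => (S.cos_angle hk p).symm.trans (congrArg Real.cos (hθ p))) (S.U k p₀)
    rw [(hasFDerivAt_inner_const k _).fderiv, innerSL_apply_apply, real_inner_comm] at hderiv
    have hprod : a * (1 - inner ℝ (S.N p₀) k ^ 2) ^ 2 = 0 :=
      neg_eq_zero.1 ((S.inner_ambientDeriv_N_U hN hab hk p₀).symm.trans hderiv)
    exact (mul_eq_zero.1 hprod).resolve_right (pow_ne_zero 2 (sub_pos.2 (hN p₀)).ne')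
  · rintro rfl
    have hconst (p : M) : inner ℝ (S.N p) k = Real.tanh (-inner ℝ b k) := by
      have hb : S.catenoidPoint k p = b := by rw [hab, zero_smul, zero_add]
      rw [← hb, catenoidPoint, inner_unitCatenoidOfNormal hk, neg_neg,
        Real.tanh_artanh (abs_lt.1 ((sq_lt_one_iff_abs_lt_one _).1 (hN p)))]
    exact ⟨_, fun p => (S.angle_eq_arccos hk p).trans (congrArg Real.arccos (hconst p))⟩

end

theorem eq_smul_N_of_forall_inner_eq_zero {p : M} {u : E3}
    (hu : ∀ X, inner ℝ (ambientDeriv S.r p X) u = 0) : u = inner ℝ (S.N p) u • S.N p := by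
  have hmem : u ∈ (LinearMap.range (ambientDeriv S.r p))ᗮ := by
    rintro _ ⟨X, rfl⟩
    exact hu X
  rw [S.range_ambientDeriv_r, Submodule.orthogonal_orthogonal] at hmem
  rw [← Submodule.starProjection_unit_singleton ℝ (S.N_unit p),
    Submodule.starProjection_eq_self_iff.2 hmem]

theorem N_eq_or_eq_neg [PreconnectedSpace M] {u : M → E3} (hu : Continuous u)
    (hunit : ∀ p, ‖u p‖ = 1) (hnormal : ∀ p X, inner ℝ (ambientDeriv S.r p X) (u p) = 0) :
    (∀ p, u p = S.N p) ∨ ∀ p, u p = -S.N p := by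
  have hu_smul (p : M) : u p = inner ℝ (S.N p) (u p) • S.N p :=
    S.eq_smul_N_of_forall_inner_eq_zero (hnormal p)
  have hsq (p : M) : inner ℝ (S.N p) (u p) ^ 2 = 1 := by
    rw [← sq_abs, ← Real.norm_eq_abs, ← mul_one ‖_‖, ← S.N_unit p, ← norm_smul, ← hu_smul, hunit,
      S.N_unit, one_pow]
  have hcont : Continuous fun p => inner ℝ (S.N p) (u p) := S.N_smooth.continuous.inner hu
  have hsign := isPreconnected_univ.eq_one_or_eq_neg_one_of_sq_eq hcont.continuousOn
    fun p _ => hsq p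
  refine hsign.imp (fun hone p => ?_) fun hneg p => ?_
  · have hp : inner ℝ (S.N p) (u p) = 1 := hone (Set.mem_univ p)
    rw [hu_smul, hp, one_smul]
  · have hp : inner ℝ (S.N p) (u p) = -1 := hneg (Set.mem_univ p)
    rw [hu_smul, hp, neg_one_smul]

theorem unitCatenoidNormal_eq_or_eq_neg [PreconnectedSpace M] (hk : ‖k‖ = 1) (ha : a ≠ 0)
    (hr : ∀ p, a • S.r p + b ∈ unitCatenoid k) :
    (∀ p, unitCatenoidNormal k (a • S.r p + b) = S.N p) ∨
      ∀ p, unitCatenoidNormal k (a • S.r p + b) = -S.N p := by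
  refine S.N_eq_or_eq_neg ?_ (fun p => norm_unitCatenoidNormal hk (hr p)) fun p X => ?_
  · exact (continuous_unitCatenoidNormal k).comp
      ((S.r_smooth.continuous.const_smul a).add continuous_const)
  · have hX := inner_mvfderiv_unitCatenoidNormal hr
      (((S.mdifferentiable_r p).const_smul a).add mdifferentiableAt_const) X
    rw [mvfderiv_smul_add_const (S.mdifferentiable_r p), smul_apply, real_inner_smul_left] at hX
    exact (mul_eq_zero.1 hX).resolve_left ha

theorem catenoidPoint_eq_or_eq_neg [PreconnectedSpace M] (hk : ‖k‖ = 1) (ha : a ≠ 0)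
    (hr : ∀ p, a • S.r p + b ∈ unitCatenoid k) :
    (∀ p, S.catenoidPoint k p = a • S.r p + b) ∨ ∀ p, S.catenoidPoint k p = -(a • S.r p + b) := by
  refine (S.unitCatenoidNormal_eq_or_eq_neg hk ha hr).imp (fun hN p => ?_) fun hN p => ?_
  · rw [catenoidPoint, ← hN, unitCatenoidOfNormal_unitCatenoidNormal hk]
  · rw [catenoidPoint, ← neg_neg (S.N p), ← hN, ← unitCatenoidNormal_neg,
      unitCatenoidOfNormal_unitCatenoidNormal hk]

theorem inner_N_sq_lt_one_of_mem_unitCatenoid [PreconnectedSpace M] (hk : ‖k‖ = 1) (ha : a ≠ 0)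
    (hr : ∀ p, a • S.r p + b ∈ unitCatenoid k) (p : M) : inner ℝ (S.N p) k ^ 2 < 1 := by
  have hν : inner ℝ (unitCatenoidNormal k (a • S.r p + b)) k ^ 2 < 1 := by
    rw [← sub_pos, one_sub_inner_unitCatenoidNormal_sq hk]
    positivity
  rcases S.unitCatenoidNormal_eq_or_eq_neg hk ha hr with hN | hN
  · rwa [hN] at hν
  · rwa [hN, inner_neg_left, neg_sq] at hν

theorem exists_catenoidPoint_eq_iff [PreconnectedSpace M] (hk : ‖k‖ = 1) :
    ((∀ p, inner ℝ (S.N p) k ^ 2 < 1) ∧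
      ∃ (a : ℝ) (b : E3), a ≠ 0 ∧ ∀ p, S.catenoidPoint k p = a • S.r p + b) ↔
      ∃ (a : ℝ) (b : E3), a ≠ 0 ∧ ∀ p, a • S.r p + b ∈ unitCatenoid k := by
  constructor
  · rintro ⟨hN, a, b, ha, hab⟩
    exact ⟨a, b, ha, fun p => hab p ▸ unitCatenoidOfNormal_mem hk (S.N_unit p) (hN p)⟩
  · rintro ⟨a, b, ha, hr⟩
    refine ⟨S.inner_N_sq_lt_one_of_mem_unitCatenoid hk ha hr, ?_⟩
    rcases S.catenoidPoint_eq_or_eq_neg hk ha hr with hab | hab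
    · exact ⟨a, b, ha, hab⟩
    · exact ⟨-a, -b, neg_ne_zero.2 ha, fun p => by rw [hab, neg_add, neg_smul]⟩

variable {S} in
theorem IsCanonicalPrincipalU.isPrincipalU (hcan : S.IsCanonicalPrincipalU k) :
    S.IsPrincipalU k :=
  fun p => (hcan p).imp fun _ hκ => hκ.2

variable [IsManifold (𝓡 2) ∞ M] [ConnectedSpace M]

theorem isMinimal_and_isPrincipalU_and_not_hasConstantAngle_iff (hk : ‖k‖ = 1) :
    S.IsMinimal ∧ S.IsPrincipalU k ∧ ¬ S.HasConstantAngle k ↔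
      ∃ (a : ℝ) (b : E3), a ≠ 0 ∧ ∀ p, a • S.r p + b ∈ unitCatenoid k := by
  rw [← S.exists_catenoidPoint_eq_iff hk, ← and_assoc, S.isMinimal_and_isPrincipalU_iff hk]
  constructor
  · rintro ⟨⟨hN, a, b, hab⟩, hangle⟩
    exact ⟨hN, a, b, mt (S.hasConstantAngle_iff_eq_zero hN hab hk).2 hangle, hab⟩
  · rintro ⟨hN, a, b, ha, hab⟩
    exact ⟨⟨hN, a, b, hab⟩, mt (S.hasConstantAngle_iff_eq_zero hN hab hk).1 ha⟩

theorem isMinimal_and_isCanonicalPrincipalU_iff (hk : ‖k‖ = 1) :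
    S.IsMinimal ∧ S.IsCanonicalPrincipalU k ↔
      ∃ (a : ℝ) (b : E3), a ≠ 0 ∧ ∀ p, a • S.r p + b ∈ unitCatenoid k := by
  rw [← S.exists_catenoidPoint_eq_iff hk]
  constructor
  · rintro ⟨hmin, hcan⟩
    obtain ⟨hN, a, b, hab⟩ := (S.isMinimal_and_isPrincipalU_iff hk).1 ⟨hmin, hcan.isPrincipalU⟩
    exact ⟨hN, a, b, (S.isCanonicalPrincipalU_iff_ne_zero hN hab hk).1 hcan, hab⟩
  · rintro ⟨hN, a, b, ha, hab⟩
    exact ⟨((S.isMinimal_and_isPrincipalU_iff hk).2 ⟨hN, a, b, hab⟩).1,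
      (S.isCanonicalPrincipalU_iff_ne_zero hN hab hk).2 ha⟩

end ImmersedSurface

theorem exists_range_subset_catenoid_iff {ι : Type*} {f : ι → E3} {k : E3} (hk : ‖k‖ = 1) :
    (∃ (c : ℝ) (Φ : E3 ≃ᵃⁱ[ℝ] E3), 0 < c ∧ CarriesAxisTo Φ k ∧ Set.range f ⊆ Φ '' catenoid c) ↔
      ∃ (a : ℝ) (b : E3), a ≠ 0 ∧ ∀ i, a • f i + b ∈ unitCatenoid k := by
  constructor
  · rintro ⟨c, Φ, hc, hΦ, hf⟩
    refine ⟨c⁻¹, -(c⁻¹ • Φ 0), inv_ne_zero hc.ne', fun i => ?_⟩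
    rw [← sub_eq_add_neg, ← smul_sub, ← mem_image_catenoid_iff hc.ne' hΦ]
    exact hf ⟨i, rfl⟩
  · rintro ⟨a, b, ha, hf⟩
    obtain ⟨Φ, hΦ₀, hΦ⟩ := exists_affineIsometryEquiv_carriesAxisTo hk (-(a⁻¹ • b))
    refine ⟨|a|⁻¹, Φ, inv_pos.2 (abs_pos.2 ha), hΦ, Set.range_subset_iff.2 fun i => ?_⟩
    have hscale : a • (f i - Φ 0) = a • f i + b := by
      rw [hΦ₀, sub_neg_eq_add, smul_add, smul_inv_smul₀ ha]
    rw [mem_image_catenoid_iff (inv_ne_zero (abs_ne_zero.2 ha)) hΦ, inv_inv]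
    rcases abs_choice a with h | h
    · rw [h, hscale]
      exact hf i
    · rw [h, neg_smul, hscale, neg_mem_unitCatenoid]
      exact hf i

section Charts

variable {E F : Type*} [NormedAddCommGroup E] [NormedSpace ℝ E] [NormedAddCommGroup F]
  [NormedSpace ℝ F] {M : Type*} [TopologicalSpace M] [ChartedSpace E M]

theorem injective_mvfderiv_of_eventuallyEq_comp {F' : Type*} [NormedAddCommGroup F']
    [NormedSpace ℝ F'] {f : M → F'} {u : M → F} {g : F → F'} {p : M}
    (hg : DifferentiableAt ℝ g (u p)) (hu : MDifferentiableAt 𝓘(ℝ, E) 𝓘(ℝ, F) u p)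
    (hgu : f =ᶠ[nhds p] g ∘ u) (hf : Function.Injective (mvfderiv 𝓘(ℝ, E) f p)) :
    Function.Injective (mvfderiv 𝓘(ℝ, E) u p) := by
  have hcomp : mvfderiv 𝓘(ℝ, E) f p = fderiv ℝ g (u p) ∘L mvfderiv 𝓘(ℝ, E) u p :=
    hgu.mfderiv_eq.trans (mvfderiv_comp_of_differentiableAt hg hu)
  rw [hcomp, ContinuousLinearMap.coe_comp] at hf
  exact hf.of_comp

theorem exists_openPartialHomeomorph_eqOn_of_injective_fderiv [FiniteDimensional ℝ E] {n : ℕ∞ω}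
    (hn : n ≠ 0) {G : E → E} {t : Set E} (ht : IsOpen t) (hG : ContDiffOn ℝ n G t)
    (hinj : ∀ x ∈ t, Function.Injective (fderiv ℝ G x)) {x₀ : E} (hx₀ : x₀ ∈ t) :
    ∃ e : OpenPartialHomeomorph E E, x₀ ∈ e.source ∧ e.source ⊆ t ∧ ⇑e = G ∧
      ContDiffOn ℝ n e.symm e.target := by
  have : CompleteSpace E := FiniteDimensional.complete ℝ E
  have hGat {x : E} (hx : x ∈ t) : ContDiffAt ℝ n G x := hG.contDiffAt (ht.mem_nhds hx)
  have hequiv {x : E} (hx : x ∈ t) : ∃ A : E ≃L[ℝ] E, HasFDerivAt G (A : E →L[ℝ] E) x :=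
    ⟨(LinearEquiv.ofInjectiveEndo (fderiv ℝ G x).toLinearMap
      (hinj x hx)).toContinuousLinearEquiv, ((hGat hx).differentiableAt hn).hasFDerivAt⟩
  obtain ⟨A, hA⟩ := hequiv hx₀
  let e := ((hGat hx₀).toOpenPartialHomeomorph G hA hn).restrOpen t ht
  have he : e.source ⊆ t := fun x hx => hx.2
  refine ⟨e, ⟨(hGat hx₀).mem_toOpenPartialHomeomorph_source hA hn, hx₀⟩, he, rfl, fun y hy => ?_⟩
  obtain ⟨B, hB⟩ := hequiv (he (e.map_target hy))
  exact (e.contDiffAt_symm hy hB (hGat (he (e.map_target hy)))).contDiffWithinAt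

theorem exists_mem_maximalAtlas_eqOn_of_injective_mvfderiv [FiniteDimensional ℝ E] {n : ℕ∞ω}
    (hn : n ≠ 0) [IsManifold 𝓘(ℝ, E) n M] {u : M → E} {s : Set M} (hs : IsOpen s)
    (hu : ContMDiffOn 𝓘(ℝ, E) 𝓘(ℝ, E) n u s)
    (hinj : ∀ q ∈ s, Function.Injective (mvfderiv 𝓘(ℝ, E) u q)) {p : M} (hp : p ∈ s) :
    ∃ φ ∈ IsManifold.maximalAtlas 𝓘(ℝ, E) n M, p ∈ φ.source ∧ Set.EqOn φ u φ.source := by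
  have : IsManifold 𝓘(ℝ, E) 1 M := .of_le (ENat.one_le_iff_ne_zero_withTop.2 hn)
  set ψ := chartAt E p
  have hψ : ContMDiffOn 𝓘(ℝ, E) 𝓘(ℝ, E) n ψ.symm ψ.target := contMDiffOn_chart_symm
  have hψ' : ψ.MDifferentiable 𝓘(ℝ, E) 𝓘(ℝ, E) := mdifferentiable_chart p
  let t := ψ.target ∩ ψ.symm ⁻¹' s
  have ht : IsOpen t := ψ.symm.isOpen_inter_preimage hs
  have hut : ContDiffOn ℝ n (u ∘ ψ.symm) t :=
    (hu.comp (hψ.mono Set.inter_subset_left) fun x hx => hx.2).contDiffOn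
  have hderiv : ∀ x ∈ t, Function.Injective (fderiv ℝ (u ∘ ψ.symm) x) := by
    intro x hx v w hvw
    have hux := (hu.contMDiffAt (hs.mem_nhds hx.2)).mdifferentiableAt hn
    rw [fderiv_comp_chartAt_symm_apply p hux hx.1, fderiv_comp_chartAt_symm_apply p hux hx.1] at hvw
    exact hψ'.symm.mfderiv_injective hx.1 (hinj _ hx.2 hvw)
  have hψp : ψ p ∈ t :=
    ⟨mem_chart_target E p, by rwa [Set.mem_preimage, ψ.left_inv (mem_chart_source E p)]⟩
  obtain ⟨e, hep, het, heu, hesymm⟩ :=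
    exists_openPartialHomeomorph_eqOn_of_injective_fderiv hn ht hut hderiv hψp
  have hsource {q : M} (hq : q ∈ (ψ ≫ₕ e).source) : q ∈ s ∧ (ψ ≫ₕ e) q = u q := by
    rw [ψ.trans_source] at hq
    have hqs := (het hq.2).2
    rw [Set.mem_preimage, ψ.left_inv hq.1] at hqs
    exact ⟨hqs, by rw [ψ.coe_trans, heu, Function.comp_apply, Function.comp_apply, ψ.left_inv hq.1]⟩
  refine ⟨ψ ≫ₕ e, (ψ ≫ₕ e).mem_maximalAtlas_of_contMDiffOn ?_ ?_, ?_,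
    fun q hq => (hsource hq).2⟩
  · exact (hu.mono fun q hq => (hsource hq).1).congr fun q hq => (hsource hq).2
  · refine hψ.comp (hesymm.contMDiffOn.mono ?_) ?_
    · exact fun y hy => hy.1
    · exact fun y hy => hy.2
  · exact ⟨mem_chart_source E p, hep⟩

end Charts

section CatenoidParam

theorem norm_mul_exp_arg_add_arg_div {z₀ z : ℂ} (hz₀ : z₀ ≠ 0) :
    ‖z‖ * Complex.exp ((z₀.arg + (z / z₀).arg : ℝ) * Complex.I) = z := by
  have hz₀' : (‖z₀‖ : ℂ) ≠ 0 := by simpa using hz₀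
  calc _ = ‖z₀‖ * Complex.exp (z₀.arg * Complex.I) *
        (‖z / z₀‖ * Complex.exp ((z / z₀).arg * Complex.I)) := by
        rw [norm_div]
        push_cast
        rw [add_mul, Complex.exp_add]
        field_simp
    _ = z := by
        rw [Complex.norm_mul_exp_arg_mul_I, Complex.norm_mul_exp_arg_mul_I, mul_div_cancel₀ _ hz₀]

theorem contDiffAt_arg {z : ℂ} (hz : z ∈ Complex.slitPlane) {n : ℕ∞ω} :
    ContDiffAt ℝ n Complex.arg z :=
  (Complex.imCLM.contDiff.contDiffAt.comp z
    ((Complex.contDiffAt_log hz).restrict_scalars ℝ)).congr_of_eventuallyEq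
    (.of_forall fun w => (Complex.log_im w).symm)

variable {c : ℝ}

theorem catenoid_abs : catenoid |c| = catenoid c := by
  ext v
  simp only [catenoid, Set.mem_ofPred, mul_pow, sq_abs, ← Real.cosh_abs (v 2 / _), abs_div, abs_abs]

theorem catenoidParam_abs_mul_sinh (hc : c ≠ 0) (t y : ℝ) :
    catenoidParam c (|c| * Real.sinh t) y =
      !₂[|c| * Real.cosh t * Real.cos y, |c| * Real.cosh t * Real.sin y, c * t] +
        (c * Real.log |c|) • EuclideanSpace.single 2 1 := by
  have hsqrt : √((|c| * Real.sinh t) ^ 2 + c ^ 2) = |c| * Real.cosh t := by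
    rw [← Real.sqrt_sq (mul_nonneg (abs_nonneg c) (Real.cosh_pos t).le)]
    congr 1
    rw [mul_pow, mul_pow, sq_abs, Real.cosh_sq]
    ring
  have hlog : Real.log (|c| * Real.sinh t + |c| * Real.cosh t) = t + Real.log |c| := by
    rw [← mul_add, Real.sinh_add_cosh, Real.log_mul (abs_ne_zero.2 hc) (Real.exp_ne_zero t),
      Real.log_exp, add_comm]
  rw [catenoidParam, hsqrt, hlog]
  ext i
  fin_cases i <;> simp [mul_add]

theorem exists_abs_mul_sinh_eq (hc : c ≠ 0) (x : ℝ) : ∃ t, |c| * Real.sinh t = x :=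
  ⟨Real.arsinh (x / |c|), by rw [Real.sinh_arsinh, mul_div_cancel₀ _ (abs_ne_zero.2 hc)]⟩

theorem catenoidParam_sub_mem_catenoid (hc : c ≠ 0) (x y : ℝ) :
    catenoidParam c x y - (c * Real.log |c|) • EuclideanSpace.single 2 1 ∈ catenoid c := by
  obtain ⟨t, rfl⟩ := exists_abs_mul_sinh_eq hc x
  rw [catenoidParam_abs_mul_sinh hc, add_sub_cancel_right]
  simp [catenoid, mul_div_cancel_left₀ t hc, mul_pow, ← mul_add]

theorem catenoidParam_eq_arsinh (hc : c ≠ 0) (x y : ℝ) :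
    catenoidParam c x y =
      !₂[|c| * Real.cosh (Real.arsinh (x / |c|)) * Real.cos y,
        |c| * Real.cosh (Real.arsinh (x / |c|)) * Real.sin y, c * Real.arsinh (x / |c|)] +
        (c * Real.log |c|) • EuclideanSpace.single 2 1 := by
  rw [← catenoidParam_abs_mul_sinh hc, Real.sinh_arsinh, mul_div_cancel₀ _ (abs_ne_zero.2 hc)]

theorem differentiable_catenoidParam (hc : c ≠ 0) :
    Differentiable ℝ fun w : EuclideanSpace ℝ (Fin 2) => catenoidParam c (w 0) (w 1) := by
  simp only [catenoidParam_eq_arsinh hc]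
  refine Differentiable.add_const _ (differentiable_euclidean.2 fun i => ?_)
  fin_cases i <;> dsimp <;> fun_prop

/-- The point `(v₀, v₁)` of the plane orthogonal to the third axis, as a complex number. -/
noncomputable def horizontalPart (v : E3) : ℂ := v 0 + v 1 * Complex.I

theorem contDiff_horizontalPart {n : ℕ∞ω} : ContDiff ℝ n horizontalPart := by
  have hcoord (i : Fin 3) : ContDiff ℝ n fun v : E3 => (v i : ℂ) :=
    Complex.ofRealCLM.contDiff.comp (contDiff_euclidean.1 contDiff_id i)
  exact (hcoord 0).add ((hcoord 1).mul contDiff_const)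

theorem norm_horizontalPart {v : E3} (hv : v ∈ catenoid c) :
    ‖horizontalPart v‖ = |c| * Real.cosh (v 2 / c) := by
  rw [horizontalPart, Complex.norm_add_mul_I, show v 0 ^ 2 + v 1 ^ 2 = _ from hv,
    Real.sqrt_sq_eq_abs, abs_mul, abs_of_pos (Real.cosh_pos _)]

theorem horizontalPart_ne_zero (hc : c ≠ 0) {v : E3} (hv : v ∈ catenoid c) :
    horizontalPart v ≠ 0 := by
  rw [← norm_ne_zero_iff, norm_horizontalPart hv]
  exact mul_ne_zero (abs_ne_zero.2 hc) (Real.cosh_pos _).ne'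

/-- The coordinates of `v` in the parametrization `catenoidParam c` of the catenoid, up to
translation along the axis; `z₀` selects the branch of the polar angle which is smooth near the
half-plane through `z₀`. -/
noncomputable def catenoidCoord (c : ℝ) (z₀ : ℂ) (v : E3) : EuclideanSpace ℝ (Fin 2) :=
  !₂[|c| * Real.sinh (v 2 / c), z₀.arg + (horizontalPart v / z₀).arg]

theorem contDiffAt_catenoidCoord {z₀ : ℂ} {v : E3} (hv : horizontalPart v / z₀ ∈ Complex.slitPlane)
    {n : ℕ∞ω} : ContDiffAt ℝ n (catenoidCoord c z₀) v := by
  rw [contDiffAt_euclidean]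
  intro i
  fin_cases i
  · dsimp [catenoidCoord]
    fun_prop
  · exact contDiffAt_const.add
      ((contDiffAt_arg hv).comp v (contDiff_horizontalPart.div_const z₀).contDiffAt)

theorem catenoidParam_catenoidCoord (hc : c ≠ 0) {z₀ : ℂ} (hz₀ : z₀ ≠ 0) {v : E3}
    (hv : v ∈ catenoid c) :
    catenoidParam c (catenoidCoord c z₀ v 0) (catenoidCoord c z₀ v 1) =
      v + (c * Real.log |c|) • EuclideanSpace.single 2 1 := by
  have hpolar := norm_mul_exp_arg_add_arg_div (z := horizontalPart v) hz₀
  rw [norm_horizontalPart hv, horizontalPart] at hpolar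
  have hcos := congrArg Complex.re hpolar
  have hsin := congrArg Complex.im hpolar
  rw [Complex.re_ofReal_mul, Complex.exp_ofReal_mul_I_re] at hcos
  rw [Complex.im_ofReal_mul, Complex.exp_ofReal_mul_I_im] at hsin
  refine (catenoidParam_abs_mul_sinh hc _ _).trans (congrArg (· + _) ?_)
  ext i
  fin_cases i
  · simpa [catenoidCoord, horizontalPart] using hcos
  · simpa [catenoidCoord, horizontalPart] using hsin
  · exact mul_div_cancel₀ _ hc

end CatenoidParam

theorem contDiff_affineIsometryEquiv {V W : Type*} [NormedAddCommGroup V] [NormedSpace ℝ V]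
    [NormedAddCommGroup W] [NormedSpace ℝ W] (Φ : V ≃ᵃⁱ[ℝ] W) {n : ℕ∞ω} : ContDiff ℝ n Φ :=
  Φ.toAffineIsometry.toContinuousAffineMap.contDiff

theorem exists_affineIsometryEquiv_add_axis (Φ : E3 ≃ᵃⁱ[ℝ] E3) (d : ℝ) :
    ∃ Ψ : E3 ≃ᵃⁱ[ℝ] E3, (∀ v, Ψ v = Φ (v + d • EuclideanSpace.single 2 1)) ∧
      ∀ k, CarriesAxisTo Φ k → CarriesAxisTo Ψ k :=
  ⟨(AffineIsometryEquiv.constVAdd ℝ E3 (d • EuclideanSpace.single 2 1)).trans Φ,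
    fun v => by simp [add_comm], fun _ hΦ => hΦ⟩

section CatenoidChart

variable {M : Type*} [TopologicalSpace M] [ChartedSpace (EuclideanSpace ℝ (Fin 2)) M]
  [IsManifold (𝓡 2) ∞ M] {c : ℝ}

theorem exists_chart_catenoidParam_eq (hc : c ≠ 0) {f : M → E3}
    (hf : ContMDiff (𝓡 2) 𝓘(ℝ, E3) ∞ f) (hinj : ∀ p, Function.Injective (mvfderiv (𝓡 2) f p))
    (hfc : ∀ p, f p ∈ catenoid c) (p : M) :
    ∃ φ ∈ IsManifold.maximalAtlas (𝓡 2) ∞ M, p ∈ φ.source ∧ ∀ q ∈ φ.source,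
      catenoidParam c (φ q 0) (φ q 1) = f q + (c * Real.log |c|) • EuclideanSpace.single 2 1 := by
  set z₀ := horizontalPart (f p)
  have hz₀ : z₀ ≠ 0 := horizontalPart_ne_zero hc (hfc p)
  let s := {q | horizontalPart (f q) / z₀ ∈ Complex.slitPlane}
  have hs : IsOpen s := Complex.isOpen_slitPlane.preimage
    ((contDiff_horizontalPart (n := ∞)).continuous.comp hf.continuous |>.div_const z₀)
  have hu (q : M) (hq : q ∈ s) : ContMDiffAt (𝓡 2) (𝓡 2) ∞ (catenoidCoord c z₀ ∘ f) q :=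
    (contDiffAt_catenoidCoord hq).contMDiffAt.comp q (hf q)
  have hparam (q : M) := catenoidParam_catenoidCoord hc hz₀ (hfc q)
  have huinj (q : M) (hq : q ∈ s) :
      Function.Injective (mvfderiv (𝓡 2) (catenoidCoord c z₀ ∘ f) q) := by
    refine injective_mvfderiv_of_eventuallyEq_comp
      ((differentiable_catenoidParam hc).sub_const
        ((c * Real.log |c|) • EuclideanSpace.single 2 1) _)
      ((hu q hq).mdifferentiableAt (by simp))
      (.of_forall fun q' => ?_) (hinj q)
    exact eq_sub_of_add_eq (hparam q').symm
  obtain ⟨φ, hφ, hpφ, hφu⟩ := exists_mem_maximalAtlas_eqOn_of_injective_mvfderiv (by simp) hs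
    (fun q hq => (hu q hq).contMDiffWithinAt) huinj (p := p) (by simp [s, z₀, div_self hz₀])
  refine ⟨φ, hφ, hpφ, fun q hq => ?_⟩
  rw [hφu hq]
  exact hparam q

theorem exists_catenoidParam_chart_iff {f : M → E3} (hf : ContMDiff (𝓡 2) 𝓘(ℝ, E3) ∞ f)
    (hinj : ∀ p, Function.Injective (mvfderiv (𝓡 2) f p)) {k : E3} :
    (∃ (c : ℝ) (Φ : E3 ≃ᵃⁱ[ℝ] E3), c ≠ 0 ∧ CarriesAxisTo Φ k ∧
        ∀ p : M, ∃ φ ∈ IsManifold.maximalAtlas (𝓡 2) ∞ M, p ∈ φ.source ∧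
          ∀ q ∈ φ.source, f q = Φ (catenoidParam c (φ q 0) (φ q 1))) ↔
      ∃ (c : ℝ) (Φ : E3 ≃ᵃⁱ[ℝ] E3), 0 < c ∧ CarriesAxisTo Φ k ∧ Set.range f ⊆ Φ '' catenoid c := by
  constructor
  · rintro ⟨c, Φ, hc, hΦ, hcharts⟩
    obtain ⟨Ψ, hΨ, hΨk⟩ := exists_affineIsometryEquiv_add_axis Φ (c * Real.log |c|)
    refine ⟨|c|, Ψ, abs_pos.2 hc, hΨk k hΦ, Set.range_subset_iff.2 fun p => ?_⟩
    obtain ⟨φ, -, hp, hφ⟩ := hcharts p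
    rw [hφ p hp, catenoid_abs]
    exact ⟨_, catenoidParam_sub_mem_catenoid hc _ _, by rw [hΨ, sub_add_cancel]⟩
  · rintro ⟨c, Φ, hc, hΦ, hfc⟩
    obtain ⟨Ψ, hΨ, hΨk⟩ := exists_affineIsometryEquiv_add_axis Φ (-(c * Real.log |c|))
    refine ⟨c, Ψ, hc.ne', hΨk k hΦ, fun p => ?_⟩
    have hv : ContMDiff (𝓡 2) 𝓘(ℝ, E3) ∞ (Φ.symm ∘ f) :=
      (contDiff_affineIsometryEquiv Φ.symm).contMDiff.comp hf
    have hvinj (q : M) : Function.Injective (mvfderiv (𝓡 2) (Φ.symm ∘ f) q) :=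
      injective_mvfderiv_of_eventuallyEq_comp
        ((contDiff_affineIsometryEquiv Φ).differentiable one_ne_zero _)
        (hv.mdifferentiableAt (by simp)) (.of_forall fun q' => (Φ.apply_symm_apply (f q')).symm)
        (hinj q)
    have hvc (q : M) : (Φ.symm ∘ f) q ∈ catenoid c := by
      obtain ⟨w, hw, hwq⟩ := hfc ⟨q, rfl⟩
      rwa [Function.comp_apply, ← hwq, Φ.symm_apply_apply]
    obtain ⟨φ, hφ, hp, hφc⟩ := exists_chart_catenoidParam_eq hc.ne' hv hvinj hvc p
    refine ⟨φ, hφ, hp, fun q hq => ?_⟩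
    rw [hΨ, hφc q hq, neg_smul, add_neg_cancel_right, Function.comp_apply, Φ.apply_symm_apply]

end CatenoidChart

theorem mainTheorem2 {M : Type*} [TopologicalSpace M] [ConnectedSpace M]
    [ChartedSpace (EuclideanSpace ℝ (Fin 2)) M] [IsManifold (𝓡 2) ∞ M]
    (S : ImmersedSurface M) (k : E3) (hk : ‖k‖ = 1) :
    ((S.IsMinimal ∧ S.IsPrincipalU k ∧ ¬ S.HasConstantAngle k) ↔
      ∃ (c : ℝ) (Φ : E3 ≃ᵃⁱ[ℝ] E3), c ≠ 0 ∧ CarriesAxisTo Φ k ∧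
        ∀ p : M, ∃ φ ∈ IsManifold.maximalAtlas (𝓡 2) ∞ M, p ∈ φ.source ∧
          ∀ q ∈ φ.source, S.r q = Φ (catenoidParam c (φ q 0) (φ q 1))) ∧
    ((S.IsMinimal ∧ S.IsCanonicalPrincipalU k) ↔
      ∃ (c : ℝ) (Φ : E3 ≃ᵃⁱ[ℝ] E3), 0 < c ∧ CarriesAxisTo Φ k ∧
        Set.range S.r ⊆ Φ '' catenoid c) := by
  have hinj (p : M) : Function.Injective (mvfderiv (𝓡 2) S.r p) := S.r_immersion p
  refine ⟨?_, ?_⟩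
  · rw [S.isMinimal_and_isPrincipalU_and_not_hasConstantAngle_iff hk,
      exists_catenoidParam_chart_iff S.r_smooth hinj, exists_range_subset_catenoid_iff hk]
  · rw [S.isMinimal_and_isCanonicalPrincipalU_iff hk, exists_range_subset_catenoid_iff hk]
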